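/- Let $\mathbb T=\mathbb R/\mathbb Z$ with its quotient distance $d$. For integers $m\ge 0$, $k\ge 1$ put $n=2m+1$, and for $f\in\mathbb T$ let $a(f)=(e^{2\pi i jf})_{j=-m}^{m}\in\mathbb C^n$. Let $\mathcal S_k=\{(f_1,\dots,f_k)\in\mathbb T^k : d(f_p,f_q)\ge 4/n \text{ for all } p\ne q\}$ and let $$\mathcal X_k=\Big\{\sum_{l=1}^k c_l\,a(f_l) : (f_1,\dots,f_k)\in\mathcal S_k,\ c_l\in\mathbb C\setminus\{0\}\Big\}$$ be the set of line spectral signals whose support consists of $k$ frequencies pairwise separated by at least $4/n$. One observes $y=x^\star+w$, where $x^\star\in\mathcal X_k$ is unknown and $w\in\mathbb C^n$ has i.i.d. circularly symmetric complex Gaussian coordinates of variance $\mathbb E|w_j|^2=\sigma^2$ (independent real and imaginary parts, each $N(0,\sigma^2/2)$), $\sigma\ge 0$. Then there is a constant $C>0$, independent of $k$, $n$ and $\sigma$, such that $$M_k:=\inf_{\hat x}\ \sup_{x^\star\in\mathcal X_k}\ \frac1n\,\mathbb E\,\|\hat x(y)-x^\star\|_2^2\ \ \ge\ \ C\,\sigma^2\,\frac{k\,\log\!\big(\frac{n}{4k}\big)}{n},$$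 where the infimum is over all measurable maps $\hat x:\mathbb C^n\to\mathbb C^n$ (and a supremum over the empty set is $0$). -/

import Mathlib

open MeasureTheory ProbabilityTheory
open scoped NNReal ENNReal

namespace LineSpectral

noncomputable section

/-- The atom `a(f) ∈ ℂⁿ`, `n = 2m+1`: the samples `exp (2πi j f)` at the integers
`j = -m, …, m`. The frequency `f` lies on the torus `ℝ / ℤ`; the coordinate with index
`i = 0, …, 2m` belongs to the sample point `j = i - m`. -/
def atom (m : ℕ) (f : UnitAddCircle) : EuclideanSpace ℂ (Fin (2 * m + 1)) :=
  WithLp.toLp 2 fun i => fourier ((i : ℤ) - (m : ℤ)) f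

/-- The `k`-tuples of frequencies on the torus that are pairwise at distance at least `4 / n`,
`n = 2m+1`; `dist` is the distance of the torus `ℝ / ℤ`. -/
def wellSeparated (m k : ℕ) : Set (Fin k → UnitAddCircle) :=
  {f | ∀ p q, p ≠ q → 4 / (2 * (m : ℝ) + 1) ≤ dist (f p) (f q)}

/-- The line spectral signals whose support consists of `k` well separated frequencies:
all of the `k` amplitudes are nonzero. -/
def signals (m k : ℕ) : Set (EuclideanSpace ℂ (Fin (2 * m + 1))) :=
  {x | ∃ f ∈ wellSeparated m k, ∃ c : Fin k → ℂ,
    (∀ l, c l ≠ 0) ∧ x = ∑ l, c l • atom m (f l)}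

/-- The circularly symmetric complex Gaussian law `𝒞𝒩(0, v)` on `ℂ`, of total variance `v`:
real and imaginary part are independent `N(0, v/2)`. -/
def complexGaussian (v : ℝ≥0) : Measure ℂ :=
  ((gaussianReal 0 (v / 2)).prod (gaussianReal 0 (v / 2))).map fun p => (⟨p.1, p.2⟩ : ℂ)

/-- The law of the noise vector `w ∈ ℂⁿ`, `n = 2m+1`, with i.i.d. `𝒞𝒩(0, σ²)` coordinates. -/
def noise (m : ℕ) (σ : ℝ≥0) : Measure (EuclideanSpace ℂ (Fin (2 * m + 1))) :=
  (Measure.pi fun _ : Fin (2 * m + 1) => complexGaussian (σ ^ 2)).map (WithLp.toLp 2)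

/-- The mean square error `(1/n) 𝔼 ‖x̂(y) - x‖²` of the estimator `x̂` when the signal is `x`
and `y = x + w` is observed. It is `∞` if the expectation is. -/
def mse (m : ℕ) (σ : ℝ≥0)
    (est : EuclideanSpace ℂ (Fin (2 * m + 1)) → EuclideanSpace ℂ (Fin (2 * m + 1)))
    (x : EuclideanSpace ℂ (Fin (2 * m + 1))) : ℝ≥0∞ :=
  (2 * (m : ℝ≥0∞) + 1)⁻¹ * ∫⁻ w, ‖est (x + w) - x‖ₑ ^ 2 ∂(noise m σ)

/-- The minimax denoising error `M_k`: the infimum, over all measurable estimators, of the worst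
mean square error over the signals with `k` well separated frequencies. -/
def minimaxRisk (m k : ℕ) (σ : ℝ≥0) : ℝ≥0∞ :=
  ⨅ (est : EuclideanSpace ℂ (Fin (2 * m + 1)) → EuclideanSpace ℂ (Fin (2 * m + 1)))
    (_ : Measurable est), ⨆ x ∈ signals m k, mse m σ est x

end

end LineSpectral

/-!
The lower bound is Bayesian. Write `n = 2m+1` and `B = ⌊n / (4 k)⌋`; if `B = 0` the logarithm in the
bound is negative, and if `σ = 0` the bound is zero, so let `B ≥ 1` and `σ > 0`. The atoms at the
frequencies `4 j / n`, `j < k B`, are orthogonal and their frequencies are pairwise `4 / n` apart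
(`orthonormal_gridAtom`, `le_dist_gridFreq`). Split them into `k` blocks of `B` atoms, and put in
each block one spike `± A u` at a uniformly random normalized atom `u` with a random sign. Such a
signal lies in `signals m k`, and by Bessel's inequality (`sum_enorm_blockCoeff_sq_le`) its squared
error is at least the sum of the squared errors of the blocks.

Within one block, with the other spikes frozen, the estimator has to tell `M = 2 B ≥ 2` hypotheses
apart, whose targets are at least `√2 A` apart from each other. Every hypothesis is a shift by a vector of
norm `A` of one Gaussian law; the likelihood ratio `L` of the shift has `𝔼 L² = exp (2 A² / σ²)`
(`hasShiftDensity_noise`), which is `√M` for `A² = σ² log M / 4`. Since `L ≤ M / 2 + L² / (2 M)`,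
the disjoint decision regions have average success probability at most `(1 + 1 / √M) / 2 ≤ 7 / 8`
(`sum_measure_preimage_le`), so that the block contributes an average error of order
`A² ~ σ² log M` (`le_sum_lintegral_sq`). Summing over the blocks gives `σ² k log (2 B) / 64`
(`le_sum_lintegral_spikes`), and `n / (4 k) < B + 1 ≤ 2 B`. The signs make the number of hypotheses
at least two even if `B = 1`.
-/

namespace LineSpectral

/-! ### Translates of a measure and their likelihood ratios -/

/-- The translate of `μ` by `v` has a density `L` with respect to `μ`, and the second moment
`∫ L² dμ` of this likelihood ratio (one plus the `χ²`-divergence) equals `χ`. -/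
def HasShiftDensity {E : Type*} [MeasurableSpace E] [Add E] (μ : Measure E) (v : E)
    (χ : ℝ≥0∞) : Prop :=
  ∃ L : E → ℝ≥0∞, Measurable L ∧ μ.map (fun x => v + x) = μ.withDensity L ∧
    ∫⁻ x, L x ^ 2 ∂μ = χ

theorem hasShiftDensity_gaussianReal {v : ℝ≥0} (hv : v ≠ 0) (c : ℝ) :
    HasShiftDensity (gaussianReal 0 v) c (ENNReal.ofReal (Real.exp (c ^ 2 / v))) := by
  have hv' : (v : ℝ) ≠ 0 := by exact_mod_cast hv
  refine ⟨fun x => ENNReal.ofReal (Real.exp ((2 * c * x - c ^ 2) / (2 * v))), by fun_prop, ?_, ?_⟩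
  · rw [gaussianReal_map_const_add, gaussianReal_of_var_ne_zero _ hv,
      gaussianReal_of_var_ne_zero _ hv,
      ← withDensity_mul _ (measurable_gaussianPDF 0 v) (by fun_prop)]
    congr 1
    ext x
    rw [Pi.mul_apply, gaussianPDF_def, gaussianPDF_def]
    dsimp only
    rw [← ENNReal.ofReal_mul (gaussianPDFReal_nonneg _ _ _), gaussianPDFReal_def,
      gaussianPDFReal_def]
    dsimp only
    rw [mul_assoc _ (Real.exp _) (Real.exp _), ← Real.exp_add]
    congr 3
    field_simp
    ring
  · have h : ∀ x : ℝ, ENNReal.ofReal (Real.exp ((2 * c * x - c ^ 2) / (2 * v))) ^ 2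
        = ENNReal.ofReal (Real.exp (-(c ^ 2 / v)) * Real.exp (2 * c / v * x)) := by
      intro x
      rw [← ENNReal.ofReal_pow (Real.exp_pos _).le, ← Real.exp_nat_mul, ← Real.exp_add]
      congr 2
      push_cast
      field_simp
      ring
    simp_rw [h]
    rw [← ofReal_integral_eq_lintegral_ofReal
        ((integrable_exp_mul_gaussianReal _).const_mul _)
        (Filter.Eventually.of_forall fun x => by positivity), integral_const_mul]
    have := congrFun (mgf_id_gaussianReal (μ := 0) (v := v)) (2 * c / v)
    simp only [mgf, id] at this
    rw [this, ← Real.exp_add]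
    congr 2
    field_simp
    ring

theorem HasShiftDensity.prod {E F : Type*} [MeasurableSpace E] [MeasurableSpace F] [Add E] [Add F]
    [MeasurableAdd E] [MeasurableAdd F]
    {μ : Measure E} {ν : Measure F} [IsFiniteMeasure μ] [IsFiniteMeasure ν] {a : E} {b : F}
    {χ ψ : ℝ≥0∞} (hμ : HasShiftDensity μ a χ) (hν : HasShiftDensity ν b ψ) :
    HasShiftDensity (μ.prod ν) (a, b) (χ * ψ) := by
  obtain ⟨K, hK, hKd, rfl⟩ := hμ
  obtain ⟨L, hL, hLd, rfl⟩ := hν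
  refine ⟨fun x => K x.1 * L x.2, by fun_prop, ?_, ?_⟩
  · rw [← prod_withDensity hK hL, ← hKd, ← hLd, Measure.map_prod_map _ _ (by fun_prop) (by fun_prop)]
    rfl
  · simp_rw [mul_pow]
    exact lintegral_prod_mul (f := fun x => K x ^ 2) (g := fun x => L x ^ 2)
      (by fun_prop) (by fun_prop)

/-- Likelihood ratios are invariant under additive measurable isomorphisms. -/
theorem HasShiftDensity.map {E F : Type*} [MeasurableSpace E] [MeasurableSpace F] [Add E] [Add F]
    [MeasurableAdd E] [MeasurableAdd F] {μ : Measure E} {a : E} {χ : ℝ≥0∞}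
    (hμ : HasShiftDensity μ a χ) (e : E ≃ᵐ F) (he : ∀ x, e (a + x) = e a + e x) :
    HasShiftDensity (μ.map e) (e a) χ := by
  obtain ⟨L, hL, hLd, rfl⟩ := hμ
  refine ⟨fun y => L (e.symm y), by fun_prop, ?_, ?_⟩
  · have h : (fun y => e a + y) ∘ e = e ∘ fun x => a + x := funext fun x => (he x).symm
    rw [Measure.map_map (by fun_prop) e.measurable, h,
      ← Measure.map_map e.measurable (by fun_prop), hLd]
    ext s hs
    rw [e.map_apply, withDensity_apply _ (e.measurable hs), withDensity_apply _ hs,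
      setLIntegral_map hs (by fun_prop) e.measurable]
    simp
  · rw [lintegral_map (by fun_prop) e.measurable]
    simp

theorem lintegral_pi_prod {ι : Type*} [Fintype ι] {E : ι → Type*} [∀ i, MeasurableSpace (E i)]
    (μ : ∀ i, Measure (E i)) [∀ i, IsProbabilityMeasure (μ i)] {f : ∀ i, E i → ℝ≥0∞}
    (hf : ∀ i, Measurable (f i)) :
    ∫⁻ x, ∏ i, f i (x i) ∂(Measure.pi μ) = ∏ i, ∫⁻ x, f i x ∂(μ i) := by
  rw [lintegral_prod_eq_prod_lintegral_of_indepFun Finset.univ (fun i (x : ∀ i, E i) => f i (x i))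
    (iIndepFun_pi fun i => (hf i).aemeasurable) (fun i => (hf i).comp (measurable_pi_apply i))]
  refine Finset.prod_congr rfl fun i _ => ?_
  rw [← (measurePreserving_eval μ i).map_eq, lintegral_map (hf i) (measurable_pi_apply i)]

/-- The second moments of likelihood ratios multiply over independent coordinates. -/
theorem HasShiftDensity.pi {ι : Type*} [Fintype ι] {E : ι → Type*} [∀ i, MeasurableSpace (E i)]
    [∀ i, Add (E i)] [∀ i, MeasurableAdd (E i)]
    {μ : ∀ i, Measure (E i)} [∀ i, IsProbabilityMeasure (μ i)] {a : ∀ i, E i} {χ : ι → ℝ≥0∞}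
    (h : ∀ i, HasShiftDensity (μ i) (a i) (χ i)) :
    HasShiftDensity (Measure.pi μ) a (∏ i, χ i) := by
  choose L hL hLd hχ using h
  refine ⟨fun x => ∏ i, L i (x i), by fun_prop, ?_, ?_⟩
  · have h1 : (fun x : ∀ i, E i => a + x) = fun x i => a i + x i := rfl
    have hp : ∀ i, IsProbabilityMeasure ((μ i).map fun x => a i + x) := fun i =>
      Measure.isProbabilityMeasure_map (by fun_prop)
    rw [h1, Measure.pi_map_pi (μ := μ) (f := fun i x => a i + x) fun i => by fun_prop]
    refine (Measure.pi_eq fun s hs => ?_)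
    rw [withDensity_apply _ (MeasurableSet.univ_pi hs), ← lintegral_indicator
      (MeasurableSet.univ_pi hs)]
    have h2 : ∀ x : ∀ i, E i, (Set.univ.pi s).indicator (fun x => ∏ i, L i (x i)) x
        = ∏ i, (s i).indicator (L i) (x i) := by
      intro x
      by_cases hx : x ∈ Set.univ.pi s
      · rw [Set.indicator_of_mem hx]
        exact Finset.prod_congr rfl fun i _ => (Set.indicator_of_mem (hx i trivial) _).symm
      · rw [Set.indicator_of_notMem hx]
        simp only [Set.mem_pi, Set.mem_univ, true_implies, not_forall] at hx
        obtain ⟨i, hi⟩ := hx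
        exact (Finset.prod_eq_zero (Finset.mem_univ i) (Set.indicator_of_notMem hi _)).symm
    simp_rw [h2]
    rw [lintegral_pi_prod μ fun i => (hL i).indicator (hs i)]
    refine Finset.prod_congr rfl fun i _ => ?_
    rw [lintegral_indicator (hs i), hLd, withDensity_apply _ (hs i)]
  · simp_rw [← Finset.prod_pow]
    rw [lintegral_pi_prod μ (f := fun i x => L i x ^ 2) fun i => by fun_prop]
    exact Finset.prod_congr rfl fun i _ => hχ i

/-! ### The complex Gaussian noise -/

instance isProbabilityMeasure_complexGaussian (v : ℝ≥0) :
    IsProbabilityMeasure (complexGaussian v) :=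
  Measure.isProbabilityMeasure_map Complex.measurableEquivRealProd.symm.measurable.aemeasurable

instance isProbabilityMeasure_noise (m : ℕ) (σ : ℝ≥0) : IsProbabilityMeasure (noise m σ) :=
  Measure.isProbabilityMeasure_map (MeasurableEquiv.toLp 2 _).measurable.aemeasurable

theorem hasShiftDensity_complexGaussian {v : ℝ≥0} (hv : v ≠ 0) (c : ℂ) :
    HasShiftDensity (complexGaussian v) c (ENNReal.ofReal (Real.exp (2 * ‖c‖ ^ 2 / v))) := by
  have hv2 : v / 2 ≠ 0 := by positivity
  have h := ((hasShiftDensity_gaussianReal hv2 c.re).prod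
    (hasShiftDensity_gaussianReal hv2 c.im)).map Complex.measurableEquivRealProd.symm
    (fun x => rfl)
  have hv' : (v : ℝ) ≠ 0 := by exact_mod_cast hv
  rw [← ENNReal.ofReal_mul (Real.exp_pos _).le, ← Real.exp_add] at h
  have hχ : c.re ^ 2 / ((v / 2 : ℝ≥0) : ℝ) + c.im ^ 2 / ((v / 2 : ℝ≥0) : ℝ)
      = 2 * ‖c‖ ^ 2 / v := by
    rw [Complex.sq_norm, Complex.normSq_apply]
    push_cast
    field_simp
  rw [hχ] at h
  exact h

theorem hasShiftDensity_noise (m : ℕ) {σ : ℝ≥0} (hσ : σ ≠ 0)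
    (v : EuclideanSpace ℂ (Fin (2 * m + 1))) :
    HasShiftDensity (noise m σ) v (ENNReal.ofReal (Real.exp (2 * ‖v‖ ^ 2 / σ ^ 2))) := by
  have h := (HasShiftDensity.pi fun i =>
    hasShiftDensity_complexGaussian (pow_ne_zero 2 hσ) (v i)).map
      (MeasurableEquiv.toLp 2 (Fin (2 * m + 1) → ℂ)) (fun x => rfl)
  rw [← ENNReal.ofReal_prod_of_nonneg fun i _ => (Real.exp_pos _).le, ← Real.exp_sum,
    ← Finset.sum_div, ← Finset.mul_sum, ← EuclideanSpace.norm_sq_eq] at h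
  exact_mod_cast h

/-! ### From testing to estimation -/

/-- The inequality of arithmetic and geometric means, in the form `(x - t)² ≥ 0`. -/
theorem ennreal_le_half_add_sq_div {t : ℝ≥0} (ht : t ≠ 0) (x : ℝ≥0∞) :
    x ≤ t / 2 + (2 * t : ℝ≥0∞)⁻¹ * x ^ 2 := by
  induction x with
  | top => simp [ENNReal.mul_eq_top]
  | coe x =>
    have h2 : (2 * t : ℝ≥0∞)⁻¹ = ((2 * t)⁻¹ : ℝ≥0) := by
      rw [ENNReal.coe_inv (by positivity)]; simp
    have h1 : (t / 2 : ℝ≥0∞) = (t / 2 : ℝ≥0) := by simp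
    rw [h2, h1]
    norm_cast
    rw [← NNReal.coe_le_coe]
    have ht' : (0 : ℝ) < t := by positivity
    push_cast
    have : (t : ℝ) / 2 + (2 * (t : ℝ))⁻¹ * x ^ 2 - x = (x - t) ^ 2 / (2 * t) := by
      field_simp
      ring
    have h3 : 0 ≤ ((x : ℝ) - t) ^ 2 / (2 * t) := by positivity
    linarith

/-- Change of measure: the density `L` of the shifted law satisfies `L ≤ t / 2 + L² / (2 t)`. -/
theorem HasShiftDensity.measure_preimage_le {E : Type*} [MeasurableSpace E] [Add E]
    [MeasurableAdd E] {μ : Measure E} {v : E} {χ : ℝ≥0∞} (h : HasShiftDensity μ v χ)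
    {s : Set E} (hs : MeasurableSet s) {t : ℝ≥0} (ht : t ≠ 0) :
    μ ((fun w => v + w) ⁻¹' s) ≤ t / 2 * μ s + (2 * t : ℝ≥0∞)⁻¹ * χ := by
  obtain ⟨L, hL, hLd, rfl⟩ := h
  rw [← Measure.map_apply (by fun_prop) hs, hLd, withDensity_apply _ hs]
  calc ∫⁻ x in s, L x ∂μ ≤ ∫⁻ x in s, (t / 2 + (2 * t : ℝ≥0∞)⁻¹ * L x ^ 2) ∂μ :=
        lintegral_mono fun x => ennreal_le_half_add_sq_div ht _
    _ = t / 2 * μ s + (2 * t : ℝ≥0∞)⁻¹ * ∫⁻ x in s, L x ^ 2 ∂μ := by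
        rw [lintegral_add_left (by fun_prop), lintegral_const_mul _ (by fun_prop)]
        simp
    _ ≤ _ := by gcongr; exact Measure.restrict_le_self

/-- Among `M` shifts of `μ` whose likelihood ratios have second moment at most `χ`, no test
identifies the shift with average probability above `(1 + χ / M) / 2`. -/
theorem sum_measure_preimage_le {ι E : Type*} [Fintype ι] [Nonempty ι] [MeasurableSpace E] [Add E]
    [MeasurableAdd E] {μ : Measure E} [IsProbabilityMeasure μ] {v : ι → E} {χ : ℝ≥0∞}
    (h : ∀ i, HasShiftDensity μ (v i) χ) {s : ι → Set E} (hs : ∀ i, MeasurableSet (s i))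
    (hd : Pairwise (Function.onFun Disjoint s)) :
    ∑ i, μ ((fun w => v i + w) ⁻¹' s i) ≤ (Fintype.card ι : ℝ≥0∞) / 2 + χ / 2 := by
  have hM : (Fintype.card ι : ℝ≥0) ≠ 0 := by simp
  have hM' : (Fintype.card ι : ℝ≥0∞) ≠ 0 := by simp
  calc ∑ i, μ ((fun w => v i + w) ⁻¹' s i)
      ≤ ∑ i, ((Fintype.card ι : ℝ≥0) / 2 * μ (s i)
          + (2 * (Fintype.card ι : ℝ≥0) : ℝ≥0∞)⁻¹ * χ) :=
        Finset.sum_le_sum fun i _ => (h i).measure_preimage_le (hs i) hM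
    _ = Fintype.card ι / 2 * ∑ i, μ (s i) + χ / 2 := by
        rw [Finset.sum_add_distrib, ← Finset.mul_sum]
        simp only [Finset.sum_const, Finset.card_univ, nsmul_eq_mul, ENNReal.coe_natCast]
        congr 1
        rw [ENNReal.mul_inv (by simp) (by simp), ← mul_assoc, mul_comm (2 : ℝ≥0∞)⁻¹, ← mul_assoc,
          ENNReal.mul_inv_cancel hM' (by simp), one_mul, mul_comm, div_eq_mul_inv]
    _ ≤ Fintype.card ι / 2 * 1 + χ / 2 := by
        gcongr
        rw [← tsum_fintype (L := .unconditional _), ← measure_iUnion hd hs]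
        exact prob_le_one
    _ = _ := by rw [mul_one]

/-- Estimation is at least as hard as testing: if `2 δ`-separated targets belong to shifts with
second moment `√M`, then the average squared error is at least `δ² / 8`. The constant comes from
`(1 + 1 / √M) / 2 ≤ 7 / 8`, valid for `M ≥ 2`. -/
theorem le_sum_lintegral_sq {ι E G : Type*} [Fintype ι] [MeasurableSpace E] [Add E]
    [MeasurableAdd E] [NormedAddCommGroup G] [MeasurableSpace G] [BorelSpace G]
    [SecondCountableTopology G]
    {μ : Measure E} [IsProbabilityMeasure μ] {v : ι → E} (hM : 2 ≤ Fintype.card ι)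
    (h : ∀ i, HasShiftDensity μ (v i) (ENNReal.ofReal √(Fintype.card ι)))
    {g : E → G} (hg : Measurable g) {t : ι → G} {δ : ℝ} (hδ : 0 ≤ δ)
    (ht : ∀ i j, i ≠ j → 2 * δ ≤ ‖t i - t j‖) :
    Fintype.card ι * ENNReal.ofReal (δ ^ 2 / 8)
      ≤ ∑ i, ∫⁻ w, ‖g (v i + w) - t i‖ₑ ^ 2 ∂μ := by
  have : Nonempty ι := Fintype.card_pos_iff.1 (by omega)
  set M := Fintype.card ι with hMdef
  let s : ι → Set E := fun i => {y | ‖g y - t i‖ < δ}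
  have hs : ∀ i, MeasurableSet (s i) := fun i =>
    measurableSet_lt (by fun_prop) measurable_const
  have hd : Pairwise (Function.onFun Disjoint s) := by
    intro i j hij
    refine Set.disjoint_left.2 fun y (hi : ‖g y - t i‖ < δ) (hj : ‖g y - t j‖ < δ) => ?_
    have h1 : t i - t j = (g y - t j) - (g y - t i) := by abel
    have h2 := norm_sub_le (g y - t j) (g y - t i)
    rw [← h1] at h2
    linarith [ht i j hij]
  have htest := sum_measure_preimage_le h hs hd
  have hsqrt : (M : ℝ≥0∞) / 2 + ENNReal.ofReal √M / 2 ≤ ENNReal.ofReal (7 / 8 * M) := by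
    have hM2 : (2 : ℝ) ≤ M := by exact_mod_cast hM
    have h1 : √(M : ℝ) ≤ 3 / 4 * M := by
      rw [Real.sqrt_le_left (by positivity)]
      nlinarith
    have e : (M : ℝ≥0∞) / 2 + ENNReal.ofReal √M / 2 = ENNReal.ofReal ((M : ℝ) / 2 + √M / 2) := by
      rw [ENNReal.ofReal_add (by positivity) (by positivity),
        ENNReal.ofReal_div_of_pos (by norm_num), ENNReal.ofReal_div_of_pos (by norm_num)]
      simp
    rw [e]
    exact ENNReal.ofReal_le_ofReal (by linarith)
  have hcompl : ENNReal.ofReal (M / 8) ≤ ∑ i, μ ((fun w => v i + w) ⁻¹' s i)ᶜ := by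
    refine (ENNReal.add_le_add_iff_left (a := ENNReal.ofReal (7 / 8 * M)) (by simp)).1 ?_
    calc ENNReal.ofReal (7 / 8 * M) + ENNReal.ofReal (M / 8) = ∑ i : ι, (1 : ℝ≥0∞) := by
          rw [← ENNReal.ofReal_add (by positivity) (by positivity)]
          simp only [Finset.sum_const, Finset.card_univ, nsmul_eq_mul, mul_one]
          rw [← ENNReal.ofReal_natCast]
          congr 1
          ring
      _ = ∑ i, μ ((fun w => v i + w) ⁻¹' s i) + ∑ i, μ ((fun w => v i + w) ⁻¹' s i)ᶜ := by
          rw [← Finset.sum_add_distrib]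
          exact Finset.sum_congr rfl fun i _ =>
            (prob_add_prob_compl ((measurable_const_add (v i)) (hs i))).symm
      _ ≤ _ := by gcongr; exact htest.trans hsqrt
  calc (M : ℝ≥0∞) * ENNReal.ofReal (δ ^ 2 / 8)
      = ENNReal.ofReal (δ ^ 2) * ENNReal.ofReal (M / 8) := by
        rw [← ENNReal.ofReal_natCast, ← ENNReal.ofReal_mul (by positivity),
          ← ENNReal.ofReal_mul (by positivity)]
        congr 1
        ring
    _ ≤ ENNReal.ofReal (δ ^ 2) * ∑ i, μ ((fun w => v i + w) ⁻¹' s i)ᶜ := by gcongr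
    _ = ∑ i, ENNReal.ofReal (δ ^ 2) * μ ((fun w => v i + w) ⁻¹' s i)ᶜ := Finset.mul_sum _ _ _
    _ ≤ _ := by
        refine Finset.sum_le_sum fun i _ => ?_
        refine le_trans ?_ (mul_meas_ge_le_lintegral₀ (by fun_prop) (ENNReal.ofReal (δ ^ 2)))
        gcongr
        intro w hw
        have hw' : δ ≤ ‖g (v i + w) - t i‖ := not_lt.1 hw
        show ENNReal.ofReal (δ ^ 2) ≤ ‖g (v i + w) - t i‖ₑ ^ 2
        rw [← ofReal_norm, ← ENNReal.ofReal_pow (norm_nonneg _)]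
        exact ENNReal.ofReal_le_ofReal (by gcongr)

/-! ### Signals with one spike per block -/

section Blocks

variable {m k B : ℕ}

/-- The coefficients of a vector along the `l`-th block of the orthonormal family `u`. -/
noncomputable def blockCoeff (u : Fin k × Fin B → EuclideanSpace ℂ (Fin (2 * m + 1))) (l : Fin k) :
    EuclideanSpace ℂ (Fin (2 * m + 1)) →L[ℂ] EuclideanSpace ℂ (Fin B) :=
  (EuclideanSpace.equiv (Fin B) ℂ).symm.toContinuousLinearMap ∘L
    ContinuousLinearMap.pi fun b => innerSL ℂ (u (l, b))

theorem blockCoeff_apply (u : Fin k × Fin B → EuclideanSpace ℂ (Fin (2 * m + 1))) (l : Fin k)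
    (x : EuclideanSpace ℂ (Fin (2 * m + 1))) (b : Fin B) :
    blockCoeff u l x b = inner ℂ (u (l, b)) x := rfl

theorem sum_enorm_blockCoeff_sq_le {u : Fin k × Fin B → EuclideanSpace ℂ (Fin (2 * m + 1))}
    (hu : Orthonormal ℂ u) (x : EuclideanSpace ℂ (Fin (2 * m + 1))) :
    ∑ l, ‖blockCoeff u l x‖ₑ ^ 2 ≤ ‖x‖ₑ ^ 2 := by
  have h := hu.sum_inner_products_le (s := Finset.univ) x
  rw [Fintype.sum_prod_type] at h
  simp_rw [← ofReal_norm, ← ENNReal.ofReal_pow (norm_nonneg _)]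
  rw [← ENNReal.ofReal_sum_of_nonneg fun i _ => by positivity]
  refine ENNReal.ofReal_le_ofReal ?_
  simpa only [EuclideanSpace.norm_sq_eq, blockCoeff_apply] using h

/-- The signed spike `± A u (l, b)` in block `l`; position and sign are coded by a pair in
`Fin B × Bool`. -/
noncomputable def spike (u : Fin k × Fin B → EuclideanSpace ℂ (Fin (2 * m + 1))) (A : ℝ) (l : Fin k)
    (i : Fin B × Bool) : EuclideanSpace ℂ (Fin (2 * m + 1)) :=
  (cond i.2 (A : ℂ) (-A)) • u (l, i.1)

theorem norm_spike {u : Fin k × Fin B → EuclideanSpace ℂ (Fin (2 * m + 1))}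
    (hu : Orthonormal ℂ u) {A : ℝ} (hA : 0 ≤ A) (l : Fin k) (i : Fin B × Bool) :
    ‖spike u A l i‖ = A := by
  rw [spike, norm_smul, hu.1, mul_one]
  cases i.2 <;> simp [abs_of_nonneg hA]

theorem blockCoeff_spike {u : Fin k × Fin B → EuclideanSpace ℂ (Fin (2 * m + 1))}
    (hu : Orthonormal ℂ u) (A : ℝ) (l : Fin k) (i : Fin B × Bool) :
    blockCoeff u l (spike u A l i) = EuclideanSpace.single i.1 (cond i.2 (A : ℂ) (-A)) := by
  ext b
  rw [blockCoeff_apply, spike, inner_smul_right, orthonormal_iff_ite.1 hu,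
    PiLp.single_apply]
  simp

/-- Distinct spikes of a block are at distance `√2 A` (different positions) or `2 A` (opposite signs
at the same position). -/
theorem le_norm_blockCoeff_spike_sub {u : Fin k × Fin B → EuclideanSpace ℂ (Fin (2 * m + 1))}
    (hu : Orthonormal ℂ u) {A : ℝ} (l : Fin k) {i j : Fin B × Bool} (hij : i ≠ j) :
    2 * (A / √2) ≤ ‖blockCoeff u l (spike u A l i) - blockCoeff u l (spike u A l j)‖ := by
  refine le_of_sq_le_sq ?_ (norm_nonneg _)
  have h2 : (2 * (A / √2)) ^ 2 = 2 * A ^ 2 := by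
    rw [mul_pow, div_pow, Real.sq_sqrt (by norm_num)]
    ring
  rw [h2, blockCoeff_spike hu, blockCoeff_spike hu, norm_sub_sq (𝕜 := ℂ)]
  obtain ⟨a, p⟩ := i
  obtain ⟨b, q⟩ := j
  by_cases hab : a = b
  · subst hab
    cases p <;> cases q <;> simp [EuclideanSpace.inner_single_left] at hij ⊢ <;>
      nlinarith [sq_nonneg A]
  · cases p <;> cases q <;> simp [EuclideanSpace.inner_single_left, hab] <;>
      nlinarith [sq_nonneg A]

/-- Averaged over the signals with one signed spike per block, the squared error of any estimator
is at least `A² / 16` per block. Within a block, all the other spikes are frozen and the task is to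
tell `2 B` hypotheses apart; the choice of `A` makes the second moment of the likelihood ratios
`√(2 B)`. -/
theorem le_sum_lintegral_spikes {σ : ℝ≥0} (hσ : σ ≠ 0) (hB : 1 ≤ B)
    {u : Fin k × Fin B → EuclideanSpace ℂ (Fin (2 * m + 1))} (hu : Orthonormal ℂ u) {A : ℝ}
    (hA : 0 ≤ A) (hA2 : A ^ 2 = σ ^ 2 * Real.log (2 * B) / 4)
    {est : EuclideanSpace ℂ (Fin (2 * m + 1)) → EuclideanSpace ℂ (Fin (2 * m + 1))}
    (hest : Measurable est) :
    Fintype.card (Fin k → Fin B × Bool) * (k * ENNReal.ofReal (A ^ 2 / 16))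
      ≤ ∑ s : Fin k → Fin B × Bool,
        ∫⁻ w, ‖est (∑ l, spike u A l (s l) + w) - ∑ l, spike u A l (s l)‖ₑ ^ 2 ∂(noise m σ) := by
  have hcard : Fintype.card (Fin B × Bool) = 2 * B := by simp [mul_comm]
  have hshift : ∀ l i, HasShiftDensity (noise m σ) (spike u A l i)
      (ENNReal.ofReal √(Fintype.card (Fin B × Bool))) := by
    intro l i
    convert hasShiftDensity_noise m hσ (spike u A l i) using 2
    have hσ' : (σ : ℝ) ≠ 0 := by exact_mod_cast hσ
    have hB' : (0 : ℝ) < 2 * B := by positivity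
    rw [norm_spike hu hA, hA2, hcard, Real.sqrt_eq_rpow,
      Real.rpow_def_of_pos (by exact_mod_cast hB')]
    push_cast
    congr 1
    field_simp
    ring
  have hblock : ∀ l (z : EuclideanSpace ℂ (Fin (2 * m + 1))),
      Fintype.card (Fin B × Bool) * ENNReal.ofReal (A ^ 2 / 16) ≤
        ∑ i, ∫⁻ w, ‖blockCoeff u l (est (spike u A l i + z + w) - (spike u A l i + z))‖ₑ ^ 2
          ∂(noise m σ) := by
    intro l z
    have hg : Measurable fun y => blockCoeff u l (est (y + z) - z) := by fun_prop
    have h := le_sum_lintegral_sq (by omega) (hshift l) hg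
      (t := fun i => blockCoeff u l (spike u A l i)) (δ := A / √2) (by positivity)
      fun i j hij => le_norm_blockCoeff_spike_sub hu l hij
    have e : (A / √2) ^ 2 / 8 = A ^ 2 / 16 := by
      rw [div_pow, Real.sq_sqrt (by norm_num)]
      ring
    rw [e] at h
    refine h.trans_eq (Finset.sum_congr rfl fun i _ => lintegral_congr fun w => ?_)
    rw [← map_sub, add_right_comm, sub_add_eq_sub_sub_swap]
  have hsum : ∀ l, Fintype.card (Fin k → Fin B × Bool) * ENNReal.ofReal (A ^ 2 / 16) ≤
      ∑ s : Fin k → Fin B × Bool, ∫⁻ w, ‖blockCoeff u l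
        (est (∑ l, spike u A l (s l) + w) - ∑ l, spike u A l (s l))‖ₑ ^ 2 ∂(noise m σ) := by
    intro l
    rw [← (Equiv.funSplitAt l (Fin B × Bool)).symm.sum_comp, Fintype.sum_prod_type_right,
      Fintype.card_congr (Equiv.funSplitAt l (Fin B × Bool)), Fintype.card_prod, Nat.cast_mul,
      mul_comm (Fintype.card (Fin B × Bool) : ℝ≥0∞), mul_assoc, ← nsmul_eq_mul, ← Finset.card_univ,
      ← Finset.sum_const]
    refine Finset.sum_le_sum fun r _ => ?_
    refine (hblock l (∑ j : {j // j ≠ l}, spike u A j (r j))).trans_eq ?_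
    refine Finset.sum_congr rfl fun i _ => ?_
    have hx : ∑ j, spike u A j ((Equiv.funSplitAt l (Fin B × Bool)).symm (i, r) j)
        = spike u A l i + ∑ j : {j // j ≠ l}, spike u A j (r j) := by
      rw [Fintype.sum_eq_add_sum_subtype_ne _ l]
      congr 1
      · simp
      · refine Finset.sum_congr rfl fun j _ => ?_
        simp [j.2]
    rw [hx]
  calc (Fintype.card (Fin k → Fin B × Bool) : ℝ≥0∞) * (k * ENNReal.ofReal (A ^ 2 / 16))
      = ∑ _l : Fin k, Fintype.card (Fin k → Fin B × Bool) * ENNReal.ofReal (A ^ 2 / 16) := by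
        rw [Finset.sum_const, Finset.card_univ, Fintype.card_fin, nsmul_eq_mul, mul_left_comm]
    _ ≤ _ := Finset.sum_le_sum fun l _ => hsum l
    _ = ∑ s : Fin k → Fin B × Bool, ∫⁻ w, ∑ l, ‖blockCoeff u l
        (est (∑ l, spike u A l (s l) + w) - ∑ l, spike u A l (s l))‖ₑ ^ 2 ∂(noise m σ) := by
        rw [Finset.sum_comm]
        refine Finset.sum_congr rfl fun s _ => (lintegral_finsetSum _ fun l _ => ?_).symm
        fun_prop
    _ ≤ _ := Finset.sum_le_sum fun s _ => lintegral_mono fun w =>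
        sum_enorm_blockCoeff_sq_le hu _

end Blocks

/-! ### Orthogonal atoms with well separated frequencies -/

theorem inner_atom_coe (m : ℕ) (x y : ℝ) :
    inner ℂ (atom m (x : UnitAddCircle)) (atom m (y : UnitAddCircle))
      = Complex.exp (-(2 * Real.pi * Complex.I * m * (y - x))) *
        ∑ i ∈ Finset.range (2 * m + 1), Complex.exp (2 * Real.pi * Complex.I * (y - x)) ^ i := by
  rw [← Fin.sum_univ_eq_sum_range (fun i => Complex.exp (2 * Real.pi * Complex.I * (y - x)) ^ i),
    PiLp.inner_apply, Finset.mul_sum]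
  refine Finset.sum_congr rfl fun i _ => ?_
  simp only [atom, RCLike.inner_apply]
  rw [fourier_coe_apply, fourier_coe_apply, ← Complex.exp_conj, ← Complex.exp_nat_mul,
    ← Complex.exp_add, ← Complex.exp_add]
  congr 1
  simp [Complex.conj_ofNat]
  ring

theorem norm_atom (m : ℕ) (f : UnitAddCircle) : ‖atom m f‖ = √(2 * m + 1) := by
  have h (i : Fin (2 * m + 1)) : ‖atom m f i‖ = 1 := Circle.norm_coe _
  rw [EuclideanSpace.norm_eq]
  simp [h]

/-- Atoms at two distinct points of the grid `(1 / n) ℤ / ℤ` are orthogonal: their inner product is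
a geometric sum over all the powers of a nontrivial `n`-th root of unity. -/
theorem inner_atom_grid_eq_zero (m : ℕ) {p q : ℤ} (hpq : ¬ (2 * (m : ℤ) + 1) ∣ q - p) :
    inner ℂ (atom m ((p / (2 * m + 1) : ℝ) : UnitAddCircle))
      (atom m ((q / (2 * m + 1) : ℝ) : UnitAddCircle)) = 0 := by
  have hn : (2 * (m : ℂ) + 1) ≠ 0 := by exact_mod_cast (by omega : 2 * m + 1 ≠ 0)
  rw [inner_atom_coe]
  set ω := Complex.exp (2 * Real.pi * Complex.I *
    (((q / (2 * m + 1) : ℝ) : ℂ) - ((p / (2 * m + 1) : ℝ) : ℂ))) with hω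
  have h1 : ω ≠ 1 := by
    rw [hω, Ne, Complex.exp_eq_one_iff]
    rintro ⟨r, hr⟩
    refine hpq ⟨r, ?_⟩
    have hr' := mul_right_cancel₀ Complex.two_pi_I_ne_zero ((mul_comm _ _).trans hr)
    push_cast at hr'
    field_simp at hr'
    have : ((q - p : ℤ) : ℂ) = (((2 * (m : ℤ) + 1) * r : ℤ) : ℂ) := by
      push_cast
      linear_combination hr'
    exact_mod_cast this
  have h2 : ω ^ (2 * m + 1) = 1 := by
    rw [hω, ← Complex.exp_nat_mul, Complex.exp_eq_one_iff]
    refine ⟨q - p, ?_⟩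
    push_cast
    field_simp
  rw [geom_sum_eq h1, h2]
  simp

/-- Two distinct points among `4 p / n`, `0 ≤ p < N ≤ n / 4`, are at distance at least `4 / n`, also
across the origin of the torus. -/
theorem le_dist_grid {m N : ℕ} (hN : 4 * N ≤ 2 * m + 1) {p q : ℕ} (hp : p < N) (hq : q < N)
    (hpq : p ≠ q) :
    4 / (2 * (m : ℝ) + 1) ≤ dist (((4 * p : ℕ) / (2 * m + 1) : ℝ) : UnitAddCircle)
      (((4 * q : ℕ) / (2 * m + 1) : ℝ) : UnitAddCircle) := by
  have hn : (0 : ℝ) < 2 * m + 1 := by positivity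
  rw [dist_eq_norm, ← AddCircle.coe_sub, UnitAddCircle.norm_eq]
  generalize round (((4 * p : ℕ) / (2 * m + 1) : ℝ) - (4 * q : ℕ) / (2 * m + 1)) = r
  have e : ((4 * p : ℕ) / (2 * m + 1) : ℝ) - (4 * q : ℕ) / (2 * m + 1) - r
      = ((4 * (p - q) - r * (2 * m + 1) : ℤ) : ℝ) / (2 * m + 1) := by
    push_cast
    field_simp
  rw [e, abs_div, abs_of_pos hn]
  gcongr
  rw [← Int.cast_abs]
  -- For `r = 0` this is `p ≠ q`; otherwise `|r| n ≥ n` while `4 |p - q| ≤ n - 4`.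
  have : (4 : ℤ) ≤ |4 * (p - q) - r * (2 * m + 1)| := by
    rcases lt_trichotomy r 0 with hr | rfl | hr
    · have : r * (2 * (m : ℤ) + 1) ≤ -1 * (2 * (m : ℤ) + 1) := by gcongr; omega
      rw [le_abs]
      omega
    · rw [le_abs]
      omega
    · have : 1 * (2 * (m : ℤ) + 1) ≤ r * (2 * (m : ℤ) + 1) := by gcongr; omega
      rw [le_abs]
      omega
  exact_mod_cast this

/-- The frequency of the `b`-th atom of block `l`: the point number `l B + b` of the grid
`4 j / n`, `j < k B`. -/
noncomputable def gridFreq (m : ℕ) {k B : ℕ} (i : Fin k × Fin B) : UnitAddCircle :=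
  (((4 * (finProdFinEquiv i : ℕ) : ℕ) / (2 * m + 1) : ℝ) : UnitAddCircle)

theorem le_dist_gridFreq {m k B : ℕ} (hB : 4 * (k * B) ≤ 2 * m + 1) {i j : Fin k × Fin B}
    (hij : i ≠ j) : 4 / (2 * (m : ℝ) + 1) ≤ dist (gridFreq m i) (gridFreq m j) :=
  le_dist_grid hB (finProdFinEquiv i).2 (finProdFinEquiv j).2
    fun h => hij (finProdFinEquiv.injective (Fin.ext h))

/-- The atom at the frequency `gridFreq m i`, normalized from length `√n` to length one. -/
noncomputable def gridAtom (m : ℕ) {k B : ℕ} (i : Fin k × Fin B) :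
    EuclideanSpace ℂ (Fin (2 * m + 1)) :=
  ((√(2 * m + 1))⁻¹ : ℂ) • atom m (gridFreq m i)

theorem orthonormal_gridAtom {m k B : ℕ} (hB : 4 * (k * B) ≤ 2 * m + 1) :
    Orthonormal ℂ (gridAtom m : Fin k × Fin B → _) := by
  have hn : (0 : ℝ) < 2 * m + 1 := by positivity
  refine ⟨fun i => ?_, fun i j hij => ?_⟩
  · have h0 : √(2 * (m : ℝ) + 1) ≠ 0 := by positivity
    rw [gridAtom, norm_smul, norm_atom, norm_inv, Complex.norm_real, Real.norm_eq_abs,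
      abs_of_nonneg (Real.sqrt_nonneg _), inv_mul_cancel₀ h0]
  · have hne : (finProdFinEquiv i : ℕ) ≠ finProdFinEquiv j :=
      fun h => hij (finProdFinEquiv.injective (Fin.ext h))
    have hi := (finProdFinEquiv i).2
    have hj := (finProdFinEquiv j).2
    have h := inner_atom_grid_eq_zero m (p := (4 * (finProdFinEquiv i : ℕ) : ℕ))
      (q := (4 * (finProdFinEquiv j : ℕ) : ℕ)) (by
        intro hd
        have := Int.eq_zero_of_abs_lt_dvd hd (by rw [abs_lt]; omega)
        omega)
    simp only [Int.cast_natCast] at h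
    show inner ℂ (_ • atom m (gridFreq m i)) (_ • atom m (gridFreq m j)) = 0
    rw [inner_smul_left, inner_smul_right, gridFreq, gridFreq, h]
    simp

theorem sum_spike_mem_signals {m k B : ℕ} (hB : 4 * (k * B) ≤ 2 * m + 1) {A : ℝ} (hA : A ≠ 0)
    (s : Fin k → Fin B × Bool) :
    ∑ l, spike (gridAtom m) A l (s l) ∈ signals m k := by
  have hn : (0 : ℝ) < 2 * m + 1 := by positivity
  have h0 : ((√(2 * (m : ℝ) + 1) : ℝ) : ℂ) ≠ 0 := by
    exact_mod_cast (Real.sqrt_pos.2 hn).ne'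
  have hA' : (A : ℂ) ≠ 0 := by exact_mod_cast hA
  refine ⟨fun l => gridFreq m (l, (s l).1), fun p q hpq => le_dist_gridFreq hB ?_,
    fun l => (cond (s l).2 (A : ℂ) (-A)) * ((√(2 * m + 1) : ℝ) : ℂ)⁻¹, fun l => ?_, ?_⟩
  · exact fun h => hpq (congrArg Prod.fst h)
  · refine mul_ne_zero ?_ (inv_ne_zero h0)
    cases (s l).2 <;> simpa using hA'
  · exact Finset.sum_congr rfl fun l _ => by rw [spike, gridAtom, smul_smul]

/-- The worst case over `signals m k` is at least the average over the signals with one spike per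
block. -/
theorem le_minimaxRisk {m k B : ℕ} {σ : ℝ≥0} (hσ : σ ≠ 0) (hB1 : 1 ≤ B)
    (hB : 4 * (k * B) ≤ 2 * m + 1) :
    ENNReal.ofReal (σ ^ 2 * (k * Real.log (2 * B)) / 64 / (2 * m + 1)) ≤ minimaxRisk m k σ := by
  have hB2 : (1 : ℝ) < 2 * B := by
    have : (1 : ℝ) ≤ B := by exact_mod_cast hB1
    linarith
  have hlog := Real.log_pos hB2
  have hσ' : (0 : ℝ) < σ := by positivity
  have hn : (0 : ℝ) < 2 * m + 1 := by positivity
  set A : ℝ := √(σ ^ 2 * Real.log (2 * B) / 4) with hAdef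
  have hA : 0 < A := Real.sqrt_pos.2 (by positivity)
  have hA2 : A ^ 2 = σ ^ 2 * Real.log (2 * B) / 4 := Real.sq_sqrt (by positivity)
  refine le_iInf₂ fun est hest => ?_
  have hB0 : Nonempty (Fin B) := ⟨⟨0, hB1⟩⟩
  have hcard0 : (Fintype.card (Fin k → Fin B × Bool) : ℝ≥0∞) ≠ 0 := by
    exact_mod_cast Fintype.card_ne_zero
  have hrisk := le_sum_lintegral_spikes hσ hB1 (orthonormal_gridAtom hB) hA.le hA2 hest
  have hsup : ∑ s : Fin k → Fin B × Bool, mse m σ est (∑ l, spike (gridAtom m) A l (s l))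
      ≤ Fintype.card (Fin k → Fin B × Bool) * ⨆ x ∈ signals m k, mse m σ est x := by
    rw [← nsmul_eq_mul, ← Finset.card_univ, ← Finset.sum_const]
    exact Finset.sum_le_sum fun s _ => le_iSup₂ (f := fun x _ => mse m σ est x) _
      (sum_spike_mem_signals hB hA.ne' s)
  simp_rw [mse, ← Finset.mul_sum] at hsup
  have h := (mul_le_mul_right hrisk ((2 * (m : ℝ≥0∞) + 1)⁻¹)).trans hsup
  rw [mul_left_comm, ENNReal.mul_le_mul_iff_right hcard0 (by finiteness)] at h
  refine le_trans (le_of_eq ?_) h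
  have e : (2 * (m : ℝ≥0∞) + 1) = ENNReal.ofReal (2 * m + 1) := by
    rw [ENNReal.ofReal_add (by positivity) (by norm_num), ENNReal.ofReal_mul (by norm_num)]
    simp
  rw [e, ← ENNReal.ofReal_inv_of_pos hn, ← ENNReal.ofReal_natCast,
    ← ENNReal.ofReal_mul (by positivity), ← ENNReal.ofReal_mul (by positivity), hA2]
  congr 1
  field_simp
  ring

end LineSpectral

theorem theorem3 :
    ∃ C : ℝ, 0 < C ∧ ∀ (m k : ℕ) (σ : ℝ≥0), 1 ≤ k →
      ENNReal.ofReal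
          (C * (σ : ℝ) ^ 2 * ((k : ℝ) * Real.log ((2 * (m : ℝ) + 1) / (4 * (k : ℝ)))
            / (2 * (m : ℝ) + 1)))
        ≤ LineSpectral.minimaxRisk m k σ := by
  refine ⟨1 / 64, by norm_num, fun m k σ hk => ?_⟩
  have hn : (0 : ℝ) < 2 * m + 1 := by positivity
  have hk' : (0 : ℝ) < k := by exact_mod_cast hk
  rcases eq_or_ne σ 0 with rfl | hσ
  · simp
  rcases Nat.lt_or_ge (2 * m + 1) (4 * k) with hlt | hle
  · -- The logarithm is negative.
    have hlt' : (2 * (m : ℝ) + 1) ≤ 4 * k := by exact_mod_cast hlt.le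
    have hlog : Real.log ((2 * (m : ℝ) + 1) / (4 * k)) ≤ 0 :=
      Real.log_nonpos (by positivity) (div_le_one_of_le₀ hlt' (by positivity))
    rw [ENNReal.ofReal_of_nonpos]
    · exact zero_le
    · exact mul_nonpos_of_nonneg_of_nonpos (by positivity)
        (div_nonpos_of_nonpos_of_nonneg (mul_nonpos_of_nonneg_of_nonpos hk'.le hlog) hn.le)
  · set B := (2 * m + 1) / (4 * k) with hBdef
    have hB1 : 1 ≤ B := (Nat.one_le_div_iff (by omega)).2 hle
    have hB : 4 * (k * B) ≤ 2 * m + 1 := by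
      rw [← mul_assoc]
      exact Nat.mul_div_le _ _
    refine le_trans (ENNReal.ofReal_le_ofReal ?_) (LineSpectral.le_minimaxRisk hσ hB1 hB)
    -- With `B = ⌊n / (4 k)⌋ ≥ 1`, `n / (4 k) < B + 1 ≤ 2 B`.
    have hlog : Real.log ((2 * (m : ℝ) + 1) / (4 * k)) ≤ Real.log (2 * B) := by
      refine Real.log_le_log (by positivity) ?_
      rw [div_le_iff₀ (by positivity)]
      have h1 : 2 * m + 1 < 4 * k * (B + 1) := Nat.lt_mul_div_succ _ (by omega)
      have h2 : 4 * k * (B + 1) ≤ 2 * B * (4 * k) := by nlinarith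
      exact_mod_cast (h1.trans_le h2).le
    calc 1 / 64 * (σ : ℝ) ^ 2 * (k * Real.log ((2 * (m : ℝ) + 1) / (4 * k)) / (2 * m + 1))
        ≤ 1 / 64 * (σ : ℝ) ^ 2 * (k * Real.log (2 * B) / (2 * m + 1)) := by gcongr
      _ = _ := by ring
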